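/- Let $k$ be a positive integer, let $n\ge 1$, and let $\mathbb{Z}[\tfrac12][x_1,\dots,x_n]$ be the polynomial ring in $n$ variables over $\mathbb{Z}[\tfrac12]$. Define operators on it, written on the right of their argument, by $$f\,\partial_i=\frac{f-f(\dots,x_{i+1},x_i,\dots)}{x_i-x_{i+1}}\ (1\le i<n),\qquad f\,\partial_0=\frac{f-f(-x_1,x_2,\dots)}{-x_1},$$ $$f\,\partial_\heartsuit=\frac{f-f(-x_2,-x_1,x_3,\dots)}{-x_1-x_2}\ (n\ge 2).$$ All operators act on their left, so that in a product of operators the leftmost factor is applied first, and a polynomial is regarded as the operator of multiplication by it. For $m\le n$ put $$\nabla_m^B(n)=(\partial_0\partial_1\cdots\partial_{n-1})(\partial_0\partial_1\cdots\partial_{n-2})\cdots(\partial_0\partial_1\cdots\partial_{n-m}),$$ and for $m\le n/2$ put $$\nabla_m^D(n)=(\partial_\heartsuit\partial_2\cdots\partial_{n-1}\,\partial_1\partial_2\cdots\partial_{n-2})\cdots(\partial_\heartsuit\partial_2\cdots\partial_{n-2m+1}\,\partial_1\partial_2\cdots\partial_{n-2m}),$$ where the $j$-th factor ($1\le j\le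 m$) is $\partial_\heartsuit\partial_2\cdots\partial_{n-2j+1}\,\partial_1\cdots\partial_{n-2j}$ and products over empty index ranges are omitted. Let $\mathrm{Sym}(2k)$ be the ring of symmetric polynomials in $\mathbb{Z}[\tfrac12][x_1,\dots,x_{2k}]$. Then, as operators on $\mathrm{Sym}(2k)$, $$\nabla_k^D(2k)=x_1\cdots x_{2k}\,\nabla_{2k}^B(2k)+x_1\cdots x_{2k-1}\,\nabla_{2k-1}^B(2k),$$ that is, for every $f\in\mathrm{Sym}(2k)$, $$f\,\nabla_k^D(2k)=(f\,x_1\cdots x_{2k})\,\nabla_{2k}^B(2k)+(f\,x_1\cdots x_{2k-1})\,\nabla_{2k-1}^B(2k).$$ -/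

import Mathlib

namespace OrthDivDiff

open MvPolynomial

/-- The coefficient ring `ℤ[1/2]`. -/
abbrev ZHalf : Type := Localization.Away (2 : ℤ)

instance : IsDomain ZHalf :=
  IsLocalization.isDomain_localization
    (powers_le_nonZeroDivisors_of_noZeroDivisors (by norm_num))

/-- The polynomial ring `R[x_1, …, x_n]`; the variable `x_i` is `X ⟨i - 1, _⟩`. -/
abbrev Pol (R : Type) [CommRing R] (n : ℕ) : Type := MvPolynomial (Fin n) R

variable {R : Type} [CommRing R] {n : ℕ}

theorem dvd_sub_of_vars (s : Pol R n →ₐ[R] Pol R n) (l : Pol R n)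
    (h : ∀ j, l ∣ X j - s (X j)) (f : Pol R n) : l ∣ f - s f := by
  have key : (Ideal.Quotient.mkₐ R (Ideal.span {l})) =
      (Ideal.Quotient.mkₐ R (Ideal.span {l})).comp s := by
    apply MvPolynomial.algHom_ext
    intro j
    exact Ideal.Quotient.eq.2 (Ideal.mem_span_singleton.2 (h j))
  exact Ideal.mem_span_singleton.1 (Ideal.Quotient.eq.1 (DFunLike.congr_fun key f))

/-- The divided difference `(f - s f) / l`, for a substitution `s` and a divisor `l` of all the
`x_j - s x_j` (hence of all the `f - s f`). -/
noncomputable def divDiff (s : Pol R n →ₐ[R] Pol R n) (l : Pol R n)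
    (h : ∀ j, l ∣ X j - s (X j)) (f : Pol R n) : Pol R n :=
  Classical.choose (dvd_sub_of_vars s l h f)

theorem divDiff_spec (s : Pol R n →ₐ[R] Pol R n) (l : Pol R n)
    (h : ∀ j, l ∣ X j - s (X j)) (f : Pol R n) : l * divDiff s l h f = f - s f :=
  (Classical.choose_spec (dvd_sub_of_vars s l h f)).symm

/-- Over a domain, such as `ℤ[1/2]`, and for `l ≠ 0`, the quotient is determined by its
defining equation. -/
theorem divDiff_unique [IsDomain R] (s : Pol R n →ₐ[R] Pol R n) (l : Pol R n)
    (h : ∀ j, l ∣ X j - s (X j)) (hl : l ≠ 0) (f g : Pol R n) (hg : l * g = f - s f) :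
    divDiff s l h f = g :=
  mul_left_cancel₀ hl ((divDiff_spec s l h f).trans hg.symm)

/-- The substitution exchanging `x_a` and `x_b`. -/
noncomputable def swapVars (a b : Fin n) : Pol R n →ₐ[R] Pol R n :=
  aeval (fun j => X (Equiv.swap a b j))

/-- The substitution `x_a ↦ -x_a`. -/
noncomputable def negVar (a : Fin n) : Pol R n →ₐ[R] Pol R n :=
  aeval (fun j => if j = a then -X j else X j)

/-- The substitution `x_a ↦ -x_b`, `x_b ↦ -x_a`. -/
noncomputable def negSwapVars (a b : Fin n) : Pol R n →ₐ[R] Pol R n :=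
  aeval (fun j => if j = a then -X b else if j = b then -X a else X j)

theorem swapVars_dvd (a b : Fin n) (j : Fin n) :
    (X a - X b : Pol R n) ∣ X j - swapVars a b (X j) := by
  simp only [swapVars, aeval_X]
  by_cases ha : j = a
  · subst ha; simp
  by_cases hb : j = b
  · subst hb
    rw [Equiv.swap_apply_right]
    exact ⟨-1, by ring⟩
  rw [Equiv.swap_apply_of_ne_of_ne ha hb]
  simp

theorem negVar_dvd (a : Fin n) (j : Fin n) : (-X a : Pol R n) ∣ X j - negVar a (X j) := by
  simp only [negVar, aeval_X]
  split_ifs with h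
  · subst h
    exact ⟨-2, by ring⟩
  · simp

theorem negSwapVars_dvd (a b : Fin n) (j : Fin n) :
    (-X a - X b : Pol R n) ∣ X j - negSwapVars a b (X j) := by
  simp only [negSwapVars, aeval_X]
  split_ifs with h h'
  · subst h
    exact ⟨-1, by ring⟩
  · subst h'
    exact ⟨-1, by ring⟩
  · simp

/-- `f ↦ (f - f(x_a ↔ x_b)) / (x_a - x_b)`. -/
noncomputable def divSwap (a b : Fin n) (f : Pol R n) : Pol R n :=
  divDiff (swapVars a b) (X a - X b) (swapVars_dvd a b) f

/-- `f ↦ (f - f(x_a ↦ -x_a)) / (-x_a)`. -/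
noncomputable def divNeg (a : Fin n) (f : Pol R n) : Pol R n :=
  divDiff (negVar a) (-X a) (negVar_dvd a) f

/-- `f ↦ (f - f(x_a ↦ -x_b, x_b ↦ -x_a)) / (-x_a - x_b)`. -/
noncomputable def divNegSwap (a b : Fin n) (f : Pol R n) : Pol R n :=
  divDiff (negSwapVars a b) (-X a - X b) (negSwapVars_dvd a b) f

/-- The simple divided differences `f ↦ f ∂_i` on `R[x_1, …, x_n]`, `0 ≤ i < n`:
`f ∂_0 = (f - f(-x_1, x_2, …)) / (-x_1)`, and
`f ∂_i = (f - f(…, x_{i+1}, x_i, …)) / (x_i - x_{i+1})` for `i ≥ 1`.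
(For `i ≥ n` there is no such operator; the value is `0`.) -/
noncomputable def del (i : ℕ) (f : Pol R n) : Pol R n :=
  if h : i < n then
    if i = 0 then divNeg ⟨0, by omega⟩ f
    else divSwap ⟨i - 1, by omega⟩ ⟨i, h⟩ f
  else 0

/-- The divided difference `f ↦ f ∂_♡` on `R[x_1, …, x_n]`, `n ≥ 2`:
`f ∂_♡ = (f - f(-x_2, -x_1, x_3, …)) / (-x_1 - x_2)`.
(For `n < 2` there is no such operator; the value is `0`.) -/
noncomputable def delHeart (f : Pol R n) : Pol R n :=
  if h : 2 ≤ n then divNegSwap ⟨0, by omega⟩ ⟨1, by omega⟩ f else 0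

/-- Operators act on their left: `f D_1 D_2 ⋯ D_r` applies `D_1` first. -/
def actLeft (f : Pol R n) (w : List (Pol R n → Pol R n)) : Pol R n :=
  w.foldl (fun g D => D g) f

/-- `f ↦ f ∇_k^B(n)`, for `k ≤ n`, where
`∇_k^B(n) = (∂_0 ∂_1 ⋯ ∂_{n-1}) (∂_0 ∂_1 ⋯ ∂_{n-2}) ⋯ (∂_0 ∂_1 ⋯ ∂_{n-k})`. -/
noncomputable def nablaB (k n : ℕ) (f : Pol R n) : Pol R n :=
  actLeft f ((List.range k).flatMap fun j => (List.range (n - j)).map del)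

/-- `f ↦ f ∇_k^D(n)`, for `2k ≤ n`, where `∇_k^D(n)` is
`(∂_♡ ∂_2 ⋯ ∂_{n-1} ∂_1 ∂_2 ⋯ ∂_{n-2}) ⋯ (∂_♡ ∂_2 ⋯ ∂_{n-2k+1} ∂_1 ∂_2 ⋯ ∂_{n-2k})`.
`List.Ico a b` lists `a, a + 1, …, b - 1`. -/
noncomputable def nablaD (k n : ℕ) (f : Pol R n) : Pol R n :=
  actLeft f ((List.range k).flatMap fun j =>
    delHeart :: ((List.Ico 2 (n - 2 * j)).map del ++ (List.Ico 1 (n - 2 * j - 1)).map del))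

/-- The monomial `x_1 x_2 ⋯ x_m` in `R[x_1, …, x_n]`, for `m ≤ n`. -/
noncomputable def xprod (R : Type) [CommRing R] (m n : ℕ) : Pol R n :=
  ∏ i ∈ Finset.univ.filter (fun i : Fin n => (i : ℕ) < m), X i

end OrthDivDiff

/-!
The proof is a computation with operators, written on the right as in the definitions. Let `s_0`
be the substitution `x_1 ↦ -x_1`, let `C_m = ∂_1 ⋯ ∂_{m-1}` and `R_m = ∂_0 C_m`, and consider the
product of twisted runs `W_m = (s_0 C_m) (s_0 C_{m-1}) ⋯ (s_0 C_1)`. For `n` even all three terms of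
the identity are expressed through `f W_n`.

* Since `∂_♡ = s_0 ∂_1 s_0` and `s_0` commutes with `∂_i` for `i ≥ 2`, the `j`-th factor of
  `∇_k^D(n)` is `(s_0 C_m) (s_0 C_{m-1})` with `m = n - 2j + 2`. Hence `∇_k^D(2k) = W_{2k}` on all
  polynomials (`wordD_eq_twistedRuns`).
* If `f` is symmetric in `x_1, …, x_m`, then `x_1 ∂_0 = -(1 + s_0)` and `x_{i+1} ∂_i = ∂_i x_i - 1`
  give `(f x_1 ⋯ x_{m-1}) R_m = -(f s_0 C_m) x_1 ⋯ x_{m-2}` (`delRun_zero_mul_varProd`), and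
  `f s_0 C_m` is again symmetric. By iteration, `(f x_1 ⋯ x_{n-1}) ∇_{n-1}^B(n)` is
  `(-1)^{n-1} f W_n s_0` (`wordB_mul_varProd_pred`).
* With `h = f x_1 ⋯ x_{m-1}` one has `(h x_m) R_m = (h R_m) x_{m-1} - h R_{m-1}`. The next factor of
  the word is `R_{m-1}`, and `R_{m-1} R_{m-1}` vanishes on polynomials symmetric in
  `x_1, …, x_{m-1}`, because the braid relations bring a `∂_1` to its left end
  (`delRun_zero_delRun_zero`). So the extra variable moves down with the word until the last
  factor `x_1 ∂_0 = -(1 + s_0)`, and `(f x_1 ⋯ x_n) ∇_n^B(n) = (-1)^n f W_n (1 + s_0)`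
  (`wordB_mul_varProd`).

For even `n` the sum of the last two is `f W_n (1 + s_0) - f W_n s_0 = f W_n`.

The relations among the `∂_i` are proved by clearing denominators, in any integral domain. Symmetry
in `x_1, …, x_m` is used in the form `f ∂_i = 0` for `1 ≤ i < m`.
-/

namespace OrthDivDiff
open MvPolynomial

/-! ### Braid relations for operators `f ↦ (f - s f) / a` on a domain -/

section Abstract
variable {A : Type*} [CommRing A] [IsDomain A]

/-- Commuting reflections which fix each other's roots give commuting divided differences. -/
theorem divided_difference_comm (s t : A →+* A) (a b : A) (D E : A → A) (ha : a ≠ 0) (hb : b ≠ 0)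
    (hD : ∀ f, a * D f = f - s f) (hE : ∀ f, b * E f = f - t f)
    (hst : ∀ f, s (t f) = t (s f)) (hsb : s b = b) (hta : t a = a) (f : A) :
    D (E f) = E (D f) := by
  have h1 := congrArg s (hE f)
  have h2 := congrArg t (hD f)
  simp only [map_mul, map_sub, hsb, hta] at h1 h2
  refine mul_left_cancel₀ (mul_ne_zero ha hb) ?_
  linear_combination b * hD (E f) - a * hE (D f) + hE f - h1 - hD f + h2 + hst f

/-- The braid relation of length three. Clearing denominators, both sides become the alternating
sum of `f` over the group of order six generated by `s` and `t`. -/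
theorem divided_difference_braid_three (s t : A →+* A) (a b : A) (D E : A → A)
    (ha : a ≠ 0) (hb : b ≠ 0)
    (hab : a + b ≠ 0)
    (hD : ∀ f, a * D f = f - s f) (hE : ∀ f, b * E f = f - t f)
    (hss : ∀ f, s (s f) = f) (htt : ∀ f, t (t f) = f)
    (hst : ∀ f, s (t (s f)) = t (s (t f)))
    (hsa : s a = -a) (htb : t b = -b) (hsb : s b = a + b) (hta : t a = a + b) (f : A) :
    D (E (D f)) = E (D (E f)) := by
  -- One expansion suffices: the other product is obtained by exchanging the roles of `s` and `t`.
  have key : ∀ (s t : A →+* A) (a b : A) (D E : A → A), a ≠ 0 → b ≠ 0 →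
      (∀ f, a * D f = f - s f) → (∀ f, b * E f = f - t f) →
      (∀ f, s (s f) = f) → s a = -a → s b = a + b → t a = a + b → ∀ f,
      a * b * (a + b) * D (E (D f)) =
        f - s f - t f + s (t f) + t (s f) - s (t (s f)) := by
    intro s t a b D E ha hb hD hE hss hsa hsb hta f
    have h1 := hD f
    have h2 := congrArg s h1
    have h3 := congrArg t h1
    have h4 := congrArg s h3
    have h5 := hE (D f)
    have h6 := congrArg s h5
    have h7 := hD (E (D f))
    simp only [map_mul, map_sub, map_add, hsa, hsb, hta, hss] at h2 h3 h4 h6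
    -- The first factor applied makes `D f` invariant under `s`, which removes two of the terms.
    have hse : s (D f) = D f := mul_left_cancel₀ ha (by linear_combination -h2 - h1)
    rw [hse] at h6
    linear_combination b * (a + b) * h7 + (a + b) * h5 - b * h6 + h1 - h3 + h4
  have e1 := key s t a b D E ha hb hD hE hss hsa hsb hta f
  have e2 := key t s b a E D hb ha hE hD htt htb (by rw [hta, add_comm])
    (by rw [hsb, add_comm]) f
  refine mul_left_cancel₀ (mul_ne_zero (mul_ne_zero ha hb) hab) ?_
  linear_combination e1 - e2 - hst f

/-- The braid relation of length four. Clearing denominators, both sides become the alternating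
sum of `f` over the group of order eight generated by `s` and `t`. -/
theorem divided_difference_braid_four (s t : A →+* A) (a b : A) (D E : A → A)
    (ha : a ≠ 0) (hb : b ≠ 0)
    (hab : a + b ≠ 0) (haab : b + 2 * a ≠ 0)
    (hD : ∀ f, a * D f = f - s f) (hE : ∀ f, b * E f = f - t f)
    (hss : ∀ f, s (s f) = f) (htt : ∀ f, t (t f) = f)
    (hst : ∀ f, s (t (s (t f))) = t (s (t (s f))))
    (hsa : s a = -a) (htb : t b = -b) (hsb : s b = b + 2 * a) (hta : t a = a + b) (f : A) :
    D (E (D (E f))) = E (D (E (D f))) := by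
  have hs2 : s 2 = 2 := map_ofNat s 2
  have ht2 : t 2 = 2 := map_ofNat t 2
  have e1 : a * b * (a + b) * (b + 2 * a) * D (E (D (E f))) =
      f - s f - t f + s (t f) + t (s f) - s (t (s f)) - t (s (t f)) + s (t (s (t f))) := by
    have h1 := hE f
    have h2 := congrArg s h1
    have h3 := hD (E f)
    simp only [map_mul, map_sub, hsb] at h2
    have h4 : a * b * (b + 2 * a) * D (E f) =
        (b + 2 * a) * (f - t f) - b * (s f - s (t f)) := by
      linear_combination b * (b + 2 * a) * h3 + (b + 2 * a) * h1 - b * h2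
    have h5 := congrArg t h4
    simp only [map_mul, map_sub, map_add, hta, htb, htt, ht2] at h5
    have h6 : a * b * (a + b) * (b + 2 * a) * E (D (E f)) =
        (b + 2 * a) * (f - t f) - (a + b) * (s f - s (t f)) + a * (t (s f) - t (s (t f))) := by
      refine mul_left_cancel₀ hb ?_
      linear_combination a * b * (a + b) * (b + 2 * a) * hE (D (E f)) + (a + b) * h4 + a * h5
    have h7 := congrArg s h6
    simp only [map_mul, map_sub, map_add, hsa, hsb, hss, hs2] at h7
    refine mul_left_cancel₀ ha ?_
    linear_combination a * b * (a + b) * (b + 2 * a) * hD (E (D (E f))) + h6 + h7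
  have e2 : a * b * (a + b) * (b + 2 * a) * E (D (E (D f))) =
      f - s f - t f + s (t f) + t (s f) - s (t (s f)) - t (s (t f)) + t (s (t (s f))) := by
    have h1 := hD f
    have h2 := congrArg t h1
    have h3 := hE (D f)
    simp only [map_mul, map_sub, hta] at h2
    have h4 : a * b * (a + b) * E (D f) = (a + b) * (f - s f) - a * (t f - t (s f)) := by
      linear_combination a * (a + b) * h3 + (a + b) * h1 - a * h2
    have h5 := congrArg s h4
    simp only [map_mul, map_sub, map_add, hsa, hsb, hss] at h5
    have h6 : a * b * (a + b) * (b + 2 * a) * D (E (D f)) =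
        2 * (a + b) * (f - s f) - (b + 2 * a) * (t f - t (s f))
          + b * (s (t f) - s (t (s f))) := by
      refine mul_left_cancel₀ ha ?_
      linear_combination a * b * (a + b) * (b + 2 * a) * hD (E (D f)) + (b + 2 * a) * h4 + b * h5
    have h7 := congrArg t h6
    simp only [map_mul, map_sub, map_add, hta, htb, htt, ht2] at h7
    refine mul_left_cancel₀ hb ?_
    linear_combination a * b * (a + b) * (b + 2 * a) * hE (D (E (D f))) + h6 + h7
  refine mul_left_cancel₀ (mul_ne_zero (mul_ne_zero (mul_ne_zero ha hb) hab) haab) ?_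
  linear_combination e1 - e2 + hst f
end Abstract

/-! ### The nilCoxeter relations of type B for the operators `∂_i` -/

section Relations
variable {R : Type} [CommRing R] {n : ℕ}

/-- The simple reflection `s_i` of the hyperoctahedral group, acting by substitution: `s_0` is
`x_1 ↦ -x_1`, and `s_i` exchanges `x_i` and `x_{i+1}`. It is the identity for `i ≥ n`. -/
noncomputable def simpleRefl (i : ℕ) : Pol R n →ₐ[R] Pol R n :=
  if h : i < n then
    if i = 0 then negVar ⟨0, by omega⟩ else swapVars ⟨i - 1, by omega⟩ ⟨i, h⟩
  else AlgHom.id R _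

/-- The divisor in the definition of `∂_i`: `-x_1` for `i = 0`, and `x_i - x_{i+1}` for `i ≥ 1`. -/
noncomputable def simpleRoot (R : Type) [CommRing R] (n i : ℕ) : Pol R n :=
  if h : i < n then
    if i = 0 then -X ⟨0, by omega⟩ else X ⟨i - 1, by omega⟩ - X ⟨i, h⟩
  else 1

/-- The variable `x_{i+1}`, with the index as a natural number (and `0` for `i ≥ n`). -/
noncomputable def var (R : Type) [CommRing R] (n i : ℕ) : Pol R n :=
  if h : i < n then X ⟨i, h⟩ else 0

theorem simpleRoot_zero (hn : 0 < n) : simpleRoot R n 0 = -var R n 0 := by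
  simp [simpleRoot, var, hn]

theorem simpleRoot_succ {i : ℕ} (hi : i + 1 < n) :
    simpleRoot R n (i + 1) = var R n i - var R n (i + 1) := by
  have : i < n := by omega
  simp [simpleRoot, var, hi, this]

theorem simpleRoot_mul_del {i : ℕ} (hi : i < n) (f : Pol R n) :
    simpleRoot R n i * del i f = f - simpleRefl i f := by
  unfold simpleRoot del simpleRefl
  rw [dif_pos hi, dif_pos hi, dif_pos hi]
  split_ifs
  · exact divDiff_spec _ _ _ _
  · exact divDiff_spec _ _ _ _

theorem simpleRefl_zero_var {j : ℕ} :
    simpleRefl 0 (var R n j) = if j = 0 then -var R n 0 else var R n j := by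
  by_cases hj : j < n
  · have h0 : 0 < n := by omega
    simp only [simpleRefl, var, hj, h0, negVar, dif_pos, if_true, aeval_X, Fin.mk.injEq]
    split_ifs with h
    · subst h; rfl
    · rfl
  · have : j = 0 → ¬ 0 < n := by omega
    split_ifs with h <;> simp [var, hj, h, this]

theorem simpleRefl_succ_var {i j : ℕ} (hi : i + 1 < n) :
    simpleRefl (i + 1) (var R n j) =
      if j = i then var R n (i + 1) else if j = i + 1 then var R n i else var R n j := by
  have : i < n := by omega
  unfold simpleRefl var
  split_ifs <;> simp_all [swapVars, Equiv.swap_apply_def]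

/-- A substitution is determined by its values on the variables. -/
theorem algHom_eq_of_var {s t : Pol R n →ₐ[R] Pol R n}
    (h : ∀ j, s (var R n j) = t (var R n j)) (f : Pol R n) : s f = t f := by
  refine DFunLike.congr_fun (MvPolynomial.algHom_ext fun j => ?_) f
  simpa [var] using h j

theorem simpleRefl_simpleRefl {i : ℕ} (f : Pol R n) :
    simpleRefl i (simpleRefl i f) = f := by
  by_cases hi : i < n
  · refine algHom_eq_of_var (s := (simpleRefl i).comp (simpleRefl i)) (t := AlgHom.id R _)
      (fun j => ?_) f
    simp only [AlgHom.comp_apply, AlgHom.id_apply]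
    rcases i with _ | i
    · rw [simpleRefl_zero_var]
      split_ifs with h <;> simp [simpleRefl_zero_var, h]
    · rw [simpleRefl_succ_var hi]
      split_ifs with h h' <;> simp [simpleRefl_succ_var hi, *]
  · simp [simpleRefl, hi]

theorem simpleRefl_comm {i j : ℕ} (hij : i + 1 < j) (hj : j < n) (f : Pol R n) :
    simpleRefl i (simpleRefl j f) = simpleRefl j (simpleRefl i f) := by
  refine algHom_eq_of_var (s := (simpleRefl i).comp (simpleRefl j))
    (t := (simpleRefl j).comp (simpleRefl i)) (fun l => ?_) f
  obtain ⟨j, rfl⟩ : ∃ j', j = j' + 1 := ⟨j - 1, by omega⟩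
  rcases i with _ | i
  · simp only [AlgHom.comp_apply, simpleRefl_succ_var hj, simpleRefl_zero_var,
      apply_ite (DFunLike.coe (simpleRefl (R := R) (n := n) _)), map_neg]
    split_ifs <;> first | rfl | contradiction | omega
  · have hi : i + 1 < n := by omega
    simp only [AlgHom.comp_apply, simpleRefl_succ_var hj, simpleRefl_succ_var hi,
      apply_ite (DFunLike.coe (simpleRefl (R := R) (n := n) _))]
    split_ifs <;> first | rfl | contradiction | omega

theorem simpleRefl_braid {i : ℕ} (hi : i + 2 < n) (f : Pol R n) :
    simpleRefl (i + 1) (simpleRefl (i + 2) (simpleRefl (i + 1) f)) =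
      simpleRefl (i + 2) (simpleRefl (i + 1) (simpleRefl (i + 2) f)) := by
  have hi' : i + 1 < n := by omega
  refine algHom_eq_of_var
    (s := ((simpleRefl (i + 1)).comp (simpleRefl (i + 2))).comp (simpleRefl (i + 1)))
    (t := ((simpleRefl (i + 2)).comp (simpleRefl (i + 1))).comp (simpleRefl (i + 2)))
    (fun l => ?_) f
  simp only [AlgHom.comp_apply, simpleRefl_succ_var hi, simpleRefl_succ_var hi',
    apply_ite (DFunLike.coe (simpleRefl (R := R) (n := n) _))]
  split_ifs <;> first | rfl | contradiction | omega

theorem simpleRefl_one_var (hn : 1 < n) (j : ℕ) :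
    simpleRefl 1 (var R n j) =
      if j = 0 then var R n 1 else if j = 1 then var R n 0 else var R n j :=
  simpleRefl_succ_var (i := 0) hn

theorem simpleRefl_braid_zero (hn : 1 < n) (f : Pol R n) :
    simpleRefl 0 (simpleRefl 1 (simpleRefl 0 (simpleRefl 1 f))) =
      simpleRefl 1 (simpleRefl 0 (simpleRefl 1 (simpleRefl 0 f))) := by
  refine algHom_eq_of_var
    (s := ((simpleRefl 0).comp (simpleRefl 1)).comp ((simpleRefl 0).comp (simpleRefl 1)))
    (t := ((simpleRefl 1).comp (simpleRefl 0)).comp ((simpleRefl 1).comp (simpleRefl 0)))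
    (fun l => ?_) f
  simp only [AlgHom.comp_apply, simpleRefl_one_var hn, simpleRefl_zero_var,
    apply_ite (DFunLike.coe (simpleRefl (R := R) (n := n) _)), map_neg]
  split_ifs <;> first | rfl | contradiction

theorem simpleRefl_simpleRoot {i : ℕ} (hi : i < n) :
    simpleRefl i (simpleRoot R n i) = -simpleRoot R n i := by
  rcases i with _ | i
  · rw [simpleRoot_zero hi, map_neg, simpleRefl_zero_var, if_pos rfl]
  · rw [simpleRoot_succ hi, map_sub, simpleRefl_succ_var hi, simpleRefl_succ_var hi]
    simp

theorem simpleRefl_simpleRoot_of_lt {i j : ℕ} (hij : i + 1 < j) (hj : j < n) :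
    simpleRefl i (simpleRoot R n j) = simpleRoot R n j := by
  obtain ⟨j, rfl⟩ : ∃ j', j = j' + 1 := ⟨j - 1, by omega⟩
  rw [simpleRoot_succ hj, map_sub]
  rcases i with _ | i
  · rw [simpleRefl_zero_var, simpleRefl_zero_var, if_neg (by omega), if_neg (by omega)]
  · have hi : i + 1 < n := by omega
    rw [simpleRefl_succ_var hi, simpleRefl_succ_var hi, if_neg (by omega), if_neg (by omega),
      if_neg (by omega), if_neg (by omega)]

theorem simpleRefl_simpleRoot_of_gt {i j : ℕ} (hij : i + 1 < j) (hj : j < n) :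
    simpleRefl j (simpleRoot R n i) = simpleRoot R n i := by
  obtain ⟨j, rfl⟩ : ∃ j', j = j' + 1 := ⟨j - 1, by omega⟩
  rcases i with _ | i
  · rw [simpleRoot_zero (by omega), map_neg, simpleRefl_succ_var hj, if_neg (by omega),
      if_neg (by omega)]
  · rw [simpleRoot_succ (by omega), map_sub, simpleRefl_succ_var hj, simpleRefl_succ_var hj,
      if_neg (by omega), if_neg (by omega), if_neg (by omega), if_neg (by omega)]

theorem var_combination_ne_zero {i j : ℕ} (hi : i < n) (hij : i ≠ j) (c d : R) (hc : c ≠ 0) :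
    C c * var R n i + C d * var R n j ≠ 0 := by
  intro h
  have := congrArg (eval fun l : Fin n => if (l : ℕ) = i then (1 : R) else 0) h
  by_cases hj : j < n
  · simp [var, hi, hj, hij.symm, hc] at this
  · simp [var, hi, hj, hc] at this


theorem simpleRefl_of_mem_symmetricSubalgebra {i : ℕ} (hi : 0 < i) {f : Pol R n}
    (hf : f ∈ symmetricSubalgebra (Fin n) R) : simpleRefl i f = f := by
  unfold simpleRefl
  split_ifs with h h'
  · omega
  · have h1 : (swapVars ⟨i - 1, by omega⟩ ⟨i, h⟩ : Pol R n →ₐ[R] Pol R n) =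
        rename (Equiv.swap ⟨i - 1, by omega⟩ ⟨i, h⟩) :=
      MvPolynomial.algHom_ext fun j => by simp [swapVars]
    rw [h1]
    exact (mem_symmetricSubalgebra f).1 hf _
  · rfl

variable [IsDomain R]

theorem simpleRoot_ne_zero (i : ℕ) : simpleRoot R n i ≠ 0 := by
  by_cases hi : i < n
  · rcases i with _ | i
    · rw [simpleRoot_zero hi]
      simpa using var_combination_ne_zero (R := R) (j := 1) hi (by omega) (-1) 0 (by simp)
    · rw [simpleRoot_succ hi]
      simpa [sub_eq_add_neg] using
        var_combination_ne_zero (R := R) (i := i) (j := i + 1) (by omega) (by omega) 1 (-1)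
          (by simp)
  · simp [simpleRoot, hi]

theorem del_eq_of_mul {i : ℕ} (hi : i < n) {f g : Pol R n}
    (h : simpleRoot R n i * g = f - simpleRefl i f) : del i f = g :=
  mul_left_cancel₀ (simpleRoot_ne_zero i) ((simpleRoot_mul_del hi f).trans h.symm)

theorem del_of_refl_eq {i : ℕ} {f : Pol R n} (h : simpleRefl i f = f) : del i f = 0 := by
  by_cases hi : i < n
  · exact del_eq_of_mul hi (by rw [h]; ring)
  · simp [del, hi]

theorem del_add (i : ℕ) (f g : Pol R n) : del i (f + g) = del i f + del i g := by
  by_cases hi : i < n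
  · refine del_eq_of_mul hi ?_
    rw [map_add]
    linear_combination simpleRoot_mul_del hi f + simpleRoot_mul_del hi g
  · simp [del, hi]

theorem del_neg (i : ℕ) (f : Pol R n) : del i (-f) = -del i f := by
  by_cases hi : i < n
  · refine del_eq_of_mul hi ?_
    rw [map_neg]
    linear_combination -simpleRoot_mul_del hi f
  · simp [del, hi]

theorem del_zero (i : ℕ) : del i (0 : Pol R n) = 0 := del_of_refl_eq (map_zero _)

theorem del_mul_of_refl_eq {i : ℕ} {c : Pol R n} (hc : simpleRefl i c = c) (f : Pol R n) :
    del i (f * c) = del i f * c := by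
  by_cases hi : i < n
  · refine del_eq_of_mul hi ?_
    rw [map_mul, hc]
    linear_combination c * simpleRoot_mul_del hi f
  · simp [del, hi]

/-- The relation `x_{i+1} ∂_i = ∂_i x_i - 1`, here with `i + 1` in place of `i`. -/
theorem del_mul_var {i : ℕ} (hi : i + 1 < n) (f : Pol R n) :
    del (i + 1) (f * var R n (i + 1)) = del (i + 1) f * var R n i - f := by
  refine del_eq_of_mul hi ?_
  rw [map_mul, simpleRefl_succ_var hi, if_neg (by omega), if_pos rfl]
  have := simpleRoot_mul_del hi f
  rw [simpleRoot_succ hi] at this ⊢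
  linear_combination var R n i * this

/-- The operator `x_1 ∂_0` is `-(1 + s_0)`. -/
theorem del_zero_mul_var (hn : 0 < n) (f : Pol R n) :
    del 0 (f * var R n 0) = -(f + simpleRefl 0 f) := by
  refine del_eq_of_mul hn ?_
  rw [map_mul, simpleRefl_zero_var, if_pos rfl, simpleRoot_zero hn]
  ring

theorem del_del {i : ℕ} (f : Pol R n) : del i (del i f) = 0 := by
  by_cases hi : i < n
  · refine del_of_refl_eq (mul_left_cancel₀ (simpleRoot_ne_zero (R := R) (n := n) i) ?_)
    have h := simpleRoot_mul_del hi f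
    have h' := congrArg (simpleRefl i) h
    rw [map_mul, map_sub, simpleRefl_simpleRoot hi, simpleRefl_simpleRefl] at h'
    linear_combination -h - h'
  · simp [del, hi]

theorem del_comm {i j : ℕ} (hij : i + 1 < j) (f : Pol R n) :
    del i (del j f) = del j (del i f) := by
  by_cases hj : j < n
  · have hi : i < n := by omega
    exact divided_difference_comm (simpleRefl i).toRingHom (simpleRefl j).toRingHom _ _ _ _
      (simpleRoot_ne_zero i) (simpleRoot_ne_zero j) (simpleRoot_mul_del hi)
      (simpleRoot_mul_del hj) (simpleRefl_comm hij hj) (simpleRefl_simpleRoot_of_lt hij hj)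
      (simpleRefl_simpleRoot_of_gt hij hj) f
  · have h : ∀ g : Pol R n, del j g = 0 := fun g => by simp [del, hj]
    rw [h, h, del_zero]

theorem del_braid {i : ℕ} (hi : i + 2 < n) (f : Pol R n) :
    del (i + 1) (del (i + 2) (del (i + 1) f)) = del (i + 2) (del (i + 1) (del (i + 2) f)) := by
  have hi' : i + 1 < n := by omega
  have e1 : simpleRefl (i + 1) (simpleRoot R n (i + 2)) =
      simpleRoot R n (i + 1) + simpleRoot R n (i + 2) := by
    rw [simpleRoot_succ hi, simpleRoot_succ hi', map_sub, simpleRefl_succ_var hi',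
      simpleRefl_succ_var hi', if_neg (by omega), if_pos rfl, if_neg (by omega),
      if_neg (by omega)]
    ring
  have e2 : simpleRefl (i + 2) (simpleRoot R n (i + 1)) =
      simpleRoot R n (i + 1) + simpleRoot R n (i + 2) := by
    rw [simpleRoot_succ hi, simpleRoot_succ hi', map_sub, simpleRefl_succ_var hi,
      simpleRefl_succ_var hi, if_neg (by omega), if_neg (by omega), if_pos rfl]
    ring
  refine divided_difference_braid_three (simpleRefl (i + 1)).toRingHom (simpleRefl (i + 2)).toRingHom
    (simpleRoot R n (i + 1)) (simpleRoot R n (i + 2)) _ _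
    (simpleRoot_ne_zero _) (simpleRoot_ne_zero _) ?_ (simpleRoot_mul_del hi')
    (simpleRoot_mul_del hi) simpleRefl_simpleRefl simpleRefl_simpleRefl (simpleRefl_braid hi)
    (simpleRefl_simpleRoot hi') (simpleRefl_simpleRoot hi) e1 e2 f
  rw [← e1]
  exact fun h => simpleRoot_ne_zero (R := R) (n := n) (i + 2)
    (by simpa [simpleRefl_simpleRefl] using congrArg (simpleRefl (i + 1)) h)

theorem del_braid_zero (hn : 1 < n) (f : Pol R n) :
    del 0 (del 1 (del 0 (del 1 f))) = del 1 (del 0 (del 1 (del 0 f))) := by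
  have hn' : 0 < n := by omega
  have h1 : simpleRoot R n 1 = var R n 0 - var R n 1 := simpleRoot_succ hn
  have e1 : simpleRefl 0 (simpleRoot R n 1) = simpleRoot R n 1 + 2 * simpleRoot R n 0 := by
    rw [h1, simpleRoot_zero hn', map_sub, simpleRefl_zero_var, simpleRefl_zero_var]
    simp
    ring
  have e2 : simpleRefl 1 (simpleRoot R n 0) = simpleRoot R n 0 + simpleRoot R n 1 := by
    rw [h1, simpleRoot_zero hn', map_neg, simpleRefl_one_var hn, if_pos rfl]
    ring
  refine divided_difference_braid_four (simpleRefl 0).toRingHom (simpleRefl 1).toRingHom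
    (simpleRoot R n 0) (simpleRoot R n 1) _ _
    (simpleRoot_ne_zero _) (simpleRoot_ne_zero _) ?_ ?_ (simpleRoot_mul_del hn')
    (simpleRoot_mul_del hn) simpleRefl_simpleRefl simpleRefl_simpleRefl
    (simpleRefl_braid_zero hn)
    (simpleRefl_simpleRoot hn') (simpleRefl_simpleRoot hn) e1 e2 f
  · rw [← e2]
    exact fun h => simpleRoot_ne_zero (R := R) (n := n) 0
      (by simpa [simpleRefl_simpleRefl] using congrArg (simpleRefl 1) h)
  · rw [← e1]
    exact fun h => simpleRoot_ne_zero (R := R) (n := n) 1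
      (by simpa [simpleRefl_simpleRefl] using congrArg (simpleRefl 0) h)

/-- `∂_i` commutes with `x_1 ↦ -x_1` for `i ≥ 2`. -/
theorem del_simpleRefl_zero {i : ℕ} (hi : 1 < i) (f : Pol R n) :
    del i (simpleRefl 0 f) = simpleRefl 0 (del i f) := by
  by_cases hn : i < n
  · refine del_eq_of_mul hn ?_
    have := congrArg (simpleRefl 0) (simpleRoot_mul_del hn f)
    rwa [map_mul, map_sub, simpleRefl_simpleRoot_of_lt hi hn, simpleRefl_comm hi hn] at this
  · simp [del, hn]

/-- `∂_♡` is the conjugate of `∂_1` by `x_1 ↦ -x_1`. -/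
theorem delHeart_eq (hn : 1 < n) (f : Pol R n) :
    delHeart f = simpleRefl 0 (del 1 (simpleRefl 0 f)) := by
  have h0 : 0 < n := by omega
  have hX0 : (X ⟨0, h0⟩ : Pol R n) = var R n 0 := by simp [var, h0]
  have hX1 : (X ⟨1, hn⟩ : Pol R n) = var R n 1 := by simp [var, hn]
  have hs : ∀ g : Pol R n, negSwapVars ⟨0, h0⟩ ⟨1, hn⟩ g =
      simpleRefl 0 (simpleRefl 1 (simpleRefl 0 g)) := by
    refine algHom_eq_of_var
      (t := ((simpleRefl 0).comp (simpleRefl 1)).comp (simpleRefl 0)) fun j => ?_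
    simp only [AlgHom.comp_apply, simpleRefl_one_var hn, simpleRefl_zero_var,
      apply_ite (DFunLike.coe (simpleRefl (R := R) (n := n) _)), map_neg]
    by_cases hj : j < n
    · simp only [negSwapVars, var, hj, h0, hn, dif_pos, aeval_X, Fin.mk.injEq]
      split_ifs <;> first | rfl | contradiction
    · simp [var, hj, show j ≠ 0 by omega, show j ≠ 1 by omega]
  have h2 : simpleRefl 0 (simpleRoot R n 1) = -var R n 0 - var R n 1 := by
    rw [simpleRoot_succ (i := 0) hn, map_sub, simpleRefl_zero_var, simpleRefl_zero_var]
    simp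
  unfold delHeart
  rw [dif_pos (show 2 ≤ n from hn)]
  refine divDiff_unique _ _ _ ?_ _ _ ?_
  · rw [hX0, hX1, ← h2]
    exact fun h => simpleRoot_ne_zero (R := R) (n := n) 1
      (by simpa [simpleRefl_simpleRefl] using congrArg (simpleRefl 0) h)
  · have := congrArg (simpleRefl 0) (simpleRoot_mul_del hn (simpleRefl 0 f))
    rwa [map_mul, map_sub, h2, simpleRefl_simpleRefl, ← hs, ← hX0, ← hX1] at this

end Relations

/-! ### Runs of consecutive divided differences -/

section Words
variable {R : Type} [CommRing R] {n : ℕ}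

/-- `f ↦ f ∂_a ∂_{a+1} ⋯ ∂_{b-1}`; it is the identity for `b ≤ a`. -/
noncomputable def delRun (a b : ℕ) (f : Pol R n) : Pol R n :=
  actLeft f ((List.Ico a b).map del)

/-- `f` is annihilated by `∂_i` for `a ≤ i < b`. For `a = 1` this says that `f` is symmetric in
`x_1, …, x_b`. -/
def DelKills (a b : ℕ) (f : Pol R n) : Prop :=
  ∀ i, a ≤ i → i < b → del i f = 0

theorem actLeft_append (f : Pol R n) (u v : List (Pol R n → Pol R n)) :
    actLeft f (u ++ v) = actLeft (actLeft f u) v :=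
  List.foldl_append

theorem delRun_of_le {a b : ℕ} (h : b ≤ a) (f : Pol R n) : delRun a b f = f := by
  simp [delRun, List.Ico.eq_nil_of_le h, actLeft]

theorem delRun_cons {a b : ℕ} (h : a < b) (f : Pol R n) :
    delRun a b f = delRun (a + 1) b (del a f) := by
  simp [delRun, List.Ico.eq_cons h, actLeft]

theorem delRun_delRun {a m b : ℕ} (ham : a ≤ m) (hmb : m ≤ b) (f : Pol R n) :
    delRun m b (delRun a m f) = delRun a b f := by
  unfold delRun
  rw [← actLeft_append, ← List.map_append, List.Ico.append_consecutive ham hmb]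

theorem delRun_succ {a b : ℕ} (h : a ≤ b) (f : Pol R n) :
    delRun a (b + 1) f = del b (delRun a b f) := by
  rw [← delRun_delRun h (Nat.le_succ b), delRun_cons (Nat.lt_succ_self b), delRun_of_le le_rfl]

theorem delRun_comm_of_forall {a b : ℕ} {D : Pol R n → Pol R n}
    (hD : ∀ i, a ≤ i → i < b → ∀ f, D (del i f) = del i (D f)) (f : Pol R n) :
    D (delRun a b f) = delRun a b (D f) := by
  rcases le_total b a with h | h
  · simp only [delRun_of_le h]
  · induction b, h using Nat.le_induction with
    | base => simp only [delRun_of_le le_rfl]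
    | succ b hb ih =>
      simp only [delRun_succ hb]
      rw [hD b hb (by omega), ih fun i h1 h2 => hD i h1 (by omega)]

theorem DelKills.mono {a b a' b' : ℕ} {f : Pol R n} (hf : DelKills a b f) (ha : a ≤ a')
    (hb : b' ≤ b) : DelKills a' b' f :=
  fun i h1 h2 => hf i (ha.trans h1) (h2.trans_le hb)

variable [IsDomain R]

theorem delRun_zero (a b : ℕ) : delRun a b (0 : Pol R n) = 0 := by
  rcases le_total b a with h | h
  · exact delRun_of_le h _
  · induction b, h using Nat.le_induction with
    | base => exact delRun_of_le le_rfl _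
    | succ b hb ih => rw [delRun_succ hb, ih, del_zero]

theorem delRun_add (a b : ℕ) (f g : Pol R n) :
    delRun a b (f + g) = delRun a b f + delRun a b g := by
  rcases le_total b a with h | h
  · simp only [delRun_of_le h]
  · induction b, h using Nat.le_induction with
    | base => simp only [delRun_of_le le_rfl]
    | succ b hb ih => simp only [delRun_succ hb, ih, del_add]

theorem delRun_neg (a b : ℕ) (f : Pol R n) : delRun a b (-f) = -delRun a b f := by
  have h := delRun_add a b f (-f)
  rw [add_neg_cancel, delRun_zero] at h
  linear_combination -h

theorem delRun_mul_of_refl_eq {a b : ℕ} {c : Pol R n}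
    (hc : ∀ i, a ≤ i → i < b → simpleRefl i c = c) (f : Pol R n) :
    delRun a b (f * c) = delRun a b f * c := by
  rcases le_total b a with h | h
  · simp only [delRun_of_le h]
  · induction b, h using Nat.le_induction with
    | base => simp only [delRun_of_le le_rfl]
    | succ b hb ih =>
      simp only [delRun_succ hb]
      rw [ih fun i h1 h2 => hc i h1 (by omega), del_mul_of_refl_eq (hc b hb (by omega))]

theorem simpleRefl_zero_delRun {a b : ℕ} (ha : 1 < a) (f : Pol R n) :
    simpleRefl 0 (delRun a b f) = delRun a b (simpleRefl 0 f) :=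
  delRun_comm_of_forall (fun _ hi _ g => (del_simpleRefl_zero (lt_of_lt_of_le ha hi) g).symm) f

/-- The relation `(∂_a ⋯ ∂_{b-1}) ∂_i = ∂_{i+1} (∂_a ⋯ ∂_{b-1})`. -/
theorem del_delRun {a b i : ℕ} (ha : 0 < a) (hai : a ≤ i) (hib : i + 1 < b) (hb : b ≤ n)
    (f : Pol R n) : del i (delRun a b f) = delRun a b (del (i + 1) f) := by
  obtain ⟨j, rfl⟩ : ∃ j, i = j + 1 := ⟨i - 1, by omega⟩
  have h : ∀ g : Pol R n, delRun a b g =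
      delRun (j + 3) b (del (j + 2) (del (j + 1) (delRun a (j + 1) g))) := fun g => by
    rw [← delRun_delRun hai (show j + 1 ≤ b by omega), delRun_cons (a := j + 1) (by omega),
      delRun_cons (a := j + 1 + 1) hib]
  rw [h, h, delRun_comm_of_forall (D := del (j + 1)) fun l hl _ g => del_comm (by omega) g,
    del_braid (by omega),
    delRun_comm_of_forall (D := del (j + 2)) fun l _ hl g => (del_comm (by omega) g).symm]

theorem delRun_delRun_shift {a b c d : ℕ} (ha : 0 < a) (hac : a ≤ c) (hcd : c ≤ d) (hdb : d < b)
    (hb : b ≤ n) (f : Pol R n) :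
    delRun c d (delRun a b f) = delRun a b (delRun (c + 1) (d + 1) f) := by
  induction d, hcd using Nat.le_induction with
  | base => simp only [delRun_of_le le_rfl]
  | succ d hd ih =>
    rw [delRun_succ hd, delRun_succ (by omega), ih (by omega),
      del_delRun ha (by omega) hdb hb]

theorem delKills_delRun {a b : ℕ} {f : Pol R n} (ha : 0 < a) (hb : b ≤ n)
    (hf : DelKills (a + 1) b f) : DelKills a b (delRun a b f) := by
  intro i hai hib
  by_cases h : i + 1 < b
  · rw [del_delRun ha hai h hb, hf _ (by omega) h, delRun_zero]
  · obtain rfl : b = i + 1 := by omega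
    rw [delRun_succ hai, del_del]

theorem delKills_simpleRefl_zero {a b : ℕ} {f : Pol R n} (hf : DelKills a b f) (ha : 1 < a) :
    DelKills a b (simpleRefl 0 f) := fun i h1 h2 => by
  rw [del_simpleRefl_zero (by omega), hf i h1 h2, map_zero]

/-- On polynomials symmetric in `x_1, …, x_p` the square of `∂_0 ⋯ ∂_{p-1}` vanishes: the braid
relations move a factor `∂_1` to its left end. -/
theorem delRun_zero_delRun_zero {p : ℕ} {f : Pol R n} (hp : 0 < p) (hpn : p ≤ n)
    (hf : DelKills 1 p f) : delRun 0 p (delRun 0 p f) = 0 := by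
  rcases (show p = 1 ∨ 1 < p by omega) with rfl | hp1
  · simp only [delRun_cons (show 0 < 1 by omega), zero_add, delRun_of_le le_rfl, del_del]
  · obtain ⟨q, rfl⟩ : ∃ q, p = q + 1 := ⟨p - 1, by omega⟩
    rw [delRun_cons (a := 0) (b := q + 1) (by omega), delRun_cons (a := 0) (b := q + 1) (by omega),
      delRun_cons (a := 0 + 1) (f := del 0 f) (by omega),
      delRun_comm_of_forall (D := del 0) fun l hl _ g => del_comm (by omega) g]
    have h := fun g : Pol R n =>
      delRun_delRun_shift (a := 1) (c := 1) (d := q) (b := q + 1) one_pos le_rfl (by omega)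
        (by omega) hpn g
    rw [zero_add, ← h, delRun_cons (a := 1) (b := q + 1) (by omega),
      ← del_braid_zero (by omega), hf 1 le_rfl hp1, del_zero, del_zero, del_zero, delRun_zero,
      delRun_zero]

end Words

/-! ### The words of types B and D as products of twisted runs -/

section Main
variable {R : Type} [CommRing R] {n : ℕ}

/-- The monomial `x_{a+1} x_{a+2} ⋯ x_b`. -/
noncomputable def varProd (R : Type) [CommRing R] (n a b : ℕ) : Pol R n :=
  ∏ i ∈ Finset.Ico a b, var R n i

theorem varProd_self (a : ℕ) : varProd R n a a = 1 := by simp [varProd]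

theorem varProd_cons {a b : ℕ} (h : a < b) :
    varProd R n a b = var R n a * varProd R n (a + 1) b :=
  Finset.prod_eq_prod_Ico_succ_bot h _

theorem varProd_succ {a b : ℕ} (h : a ≤ b) :
    varProd R n a (b + 1) = varProd R n a b * var R n b :=
  Finset.prod_Ico_succ_top h _

theorem xprod_eq_varProd {m : ℕ} (hm : m ≤ n) : xprod R m n = varProd R n 0 m := by
  have h : varProd R n 0 m = ∏ i ∈ Finset.range n, if i < m then var R n i else 1 := by
    rw [varProd, ← Finset.prod_filter]
    congr 1
    ext i
    simp only [Finset.mem_Ico, Finset.mem_filter, Finset.mem_range]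
    omega
  rw [h, ← Fin.prod_univ_eq_prod_range fun i => if i < m then var R n i else 1, xprod,
    Finset.prod_filter]
  refine Finset.prod_congr rfl fun i _ => ?_
  simp [var]

theorem simpleRefl_var_of_lt {i j : ℕ} (hij : j < i) : simpleRefl j (var R n i) = var R n i := by
  by_cases hj : j < n
  · rcases j with _ | j
    · rw [simpleRefl_zero_var, if_neg (by omega)]
    · rw [simpleRefl_succ_var hj, if_neg (by omega), if_neg (by omega)]
  · simp [simpleRefl, hj]

theorem simpleRefl_var_of_succ_lt {i j : ℕ} (hij : i + 1 < j) :
    simpleRefl j (var R n i) = var R n i := by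
  by_cases hj : j < n
  · obtain ⟨j, rfl⟩ : ∃ j', j = j' + 1 := ⟨j - 1, by omega⟩
    rw [simpleRefl_succ_var hj, if_neg (by omega), if_neg (by omega)]
  · simp [simpleRefl, hj]

theorem simpleRefl_varProd {j a b : ℕ} (hj : j < a) :
    simpleRefl j (varProd R n a b) = varProd R n a b := by
  rw [varProd, map_prod]
  refine Finset.prod_congr rfl fun i hi => simpleRefl_var_of_lt ?_
  have := Finset.mem_Ico.1 hi
  omega

theorem simpleRefl_varProd_zero {j b : ℕ} (hj : 0 < j) (hjb : j < b) (hb : b ≤ n) :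
    simpleRefl j (varProd R n 0 b) = varProd R n 0 b := by
  obtain ⟨j, rfl⟩ : ∃ j', j = j' + 1 := ⟨j - 1, by omega⟩
  rw [varProd, map_prod]
  refine Finset.prod_equiv (Equiv.swap j (j + 1)) (fun l => ?_) fun l _ => ?_
  · rw [Equiv.swap_apply_def]
    simp only [Finset.mem_Ico]
    split_ifs <;> omega
  · rw [simpleRefl_succ_var (by omega), Equiv.swap_apply_def]
    simp only [apply_ite (var R n)]

/-- `f ↦ f ∇_k^B(m)` on polynomials in `n` variables, where `m ≤ n` may be smaller than `n`; for
`m = n` this is `nablaB`. -/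
noncomputable def wordB (k m : ℕ) (f : Pol R n) : Pol R n :=
  actLeft f ((List.range k).flatMap fun j => (List.range (m - j)).map del)

theorem wordB_zero (m : ℕ) (f : Pol R n) : wordB 0 m f = f := by simp [wordB, actLeft]

/-- The words of type B are peeled from the left, so that the remaining word involves one variable
fewer. -/
theorem wordB_succ (k m : ℕ) (f : Pol R n) :
    wordB (k + 1) (m + 1) f = wordB k m (delRun 0 (m + 1) f) := by
  unfold wordB delRun
  rw [List.range_succ_eq_map, List.flatMap_cons, List.flatMap_map, actLeft_append]
  simp [List.Ico.zero_bot]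

/-- `f ↦ f ∇_k^D(m)` on polynomials in `n` variables, where `m ≤ n` may be smaller than `n`; for
`m = n` this is `nablaD`. -/
noncomputable def wordD (k m : ℕ) (f : Pol R n) : Pol R n :=
  actLeft f ((List.range k).flatMap fun j =>
    delHeart :: ((List.Ico 2 (m - 2 * j)).map del ++ (List.Ico 1 (m - 2 * j - 1)).map del))

theorem wordD_zero (m : ℕ) (f : Pol R n) : wordD 0 m f = f := by simp [wordD, actLeft]

theorem wordD_succ (k m : ℕ) (f : Pol R n) :
    wordD (k + 1) (m + 2) f = wordD k m (delRun 1 (m + 1) (delRun 2 (m + 2) (delHeart f))) := by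
  have h : ∀ j, m + 2 - 2 * (j + 1) = m - 2 * j := fun j => by omega
  unfold wordD delRun
  rw [List.range_succ_eq_map, List.flatMap_cons, List.flatMap_map, actLeft_append]
  simp only [Nat.succ_eq_add_one, h, actLeft, List.foldl_cons,
    List.foldl_append, mul_zero, Nat.sub_zero, Nat.add_succ_sub_one]

/-- `f ↦ f (s_0 ∂_1 ⋯ ∂_{m-1}) (s_0 ∂_1 ⋯ ∂_{m-2}) ⋯ (s_0 ∂_1) s_0`, where `s_0` is the
substitution `x_1 ↦ -x_1`. -/
noncomputable def twistedRuns : ℕ → Pol R n → Pol R n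
  | 0, f => f
  | m + 1, f => twistedRuns m (delRun 1 (m + 1) (simpleRefl 0 f))

theorem twistedRuns_succ (m : ℕ) (f : Pol R n) :
    twistedRuns (m + 1) f = twistedRuns m (delRun 1 (m + 1) (simpleRefl 0 f)) := rfl

variable [IsDomain R]

theorem wordB_add (k m : ℕ) (f g : Pol R n) : wordB k m (f + g) = wordB k m f + wordB k m g := by
  unfold wordB actLeft
  generalize hl : ((List.range k).flatMap fun j =>
    (List.range (m - j)).map (del : ℕ → Pol R n → Pol R n)) = l
  have h : ∀ D ∈ l, ∃ i, D = del i := by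
    subst hl
    intro D hD
    obtain ⟨j, -, hj⟩ := List.mem_flatMap.1 hD
    obtain ⟨i, -, rfl⟩ := List.mem_map.1 hj
    exact ⟨i, rfl⟩
  clear hl
  induction l generalizing f g with
  | nil => rfl
  | cons D l ih =>
    obtain ⟨i, rfl⟩ := h D List.mem_cons_self
    simp only [List.foldl_cons]
    rw [del_add, ih _ _ fun D hD => h D (List.mem_cons_of_mem _ hD)]

theorem wordB_zero_right (k m : ℕ) : wordB k m (0 : Pol R n) = 0 := by
  simpa using wordB_add k m (0 : Pol R n) 0

theorem wordB_neg (k m : ℕ) (f : Pol R n) : wordB k m (-f) = -wordB k m f := by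
  have h := wordB_add k m f (-f)
  rw [add_neg_cancel, wordB_zero_right] at h
  linear_combination -h

/-- The type `D` word is a product of twisted runs: this rests on `∂_♡ = s_0 ∂_1 s_0` and on
`s_0` commuting with `∂_i` for `i ≥ 2`. -/
theorem wordD_eq_twistedRuns {k : ℕ} (hk : 2 * k ≤ n) (f : Pol R n) :
    wordD k (2 * k) f = twistedRuns (2 * k) f := by
  induction k generalizing f with
  | zero => exact wordD_zero _ f
  | succ k ih =>
    rw [mul_add, mul_one, wordD_succ, ih (by omega), delHeart_eq (by omega),
      ← simpleRefl_zero_delRun (by omega), twistedRuns, twistedRuns,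
      delRun_cons (a := 1) (b := 2 * k + 1 + 1) (by omega)]

/-- The run `∂_{b+1} ⋯ ∂_{q+1}` shifts the factor `x_{b+2} ⋯ x_{q+1}` one step to the left. -/
theorem delRun_mul_varProd {b q : ℕ} (hbq : b ≤ q) (hq : q + 2 ≤ n) {g : Pol R n}
    (hg : DelKills (b + 2) (q + 2) g) :
    delRun (b + 1) (q + 2) (g * varProd R n (b + 1) (q + 1)) =
      delRun (b + 1) (q + 2) g * varProd R n b q := by
  induction hd : q - b generalizing b g with
  | zero =>
    obtain rfl : b = q := by omega
    simp [varProd_self]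
  | succ d ih =>
    have hb : b < q := by omega
    rw [varProd_cons (by omega), ← mul_assoc, delRun_cons (by omega),
      del_mul_of_refl_eq (simpleRefl_varProd (by omega)), del_mul_var (by omega), sub_mul,
      sub_eq_add_neg, delRun_add, delRun_neg,
      ih (b := b + 1) (by omega) ?_ (by omega),
      ih (b := b + 1) (by omega) (hg.mono (by omega) le_rfl) (by omega),
      delRun_cons (a := b + 1 + 1) (f := g) (by omega), hg (b + 1 + 1) le_rfl (by omega),
      delRun_zero, delRun_mul_of_refl_eq (fun i h _ => simpleRefl_var_of_succ_lt h),
      varProd_cons hb, delRun_cons (a := b + 1) (f := g) (by omega)]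
    · ring
    · intro i h1 h2
      rw [del_mul_of_refl_eq (simpleRefl_var_of_succ_lt (by omega)), ← del_comm (by omega),
        hg i (by omega) h2, del_zero, zero_mul]

/-- On `f x_1 ⋯ x_{m-1}`, with `f` symmetric in `x_1, …, x_m`, the run `∂_0 ⋯ ∂_{m-1}` acts as
the negative of a twisted run on `f`, and it lowers the monomial by one variable (here
`m = q + 2`). -/
theorem delRun_zero_mul_varProd {q : ℕ} (hq : q + 2 ≤ n) {f : Pol R n}
    (hf : DelKills 1 (q + 2) f) :
    delRun 0 (q + 2) (f * varProd R n 0 (q + 1)) =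
      -(delRun 1 (q + 2) (simpleRefl 0 f) * varProd R n 0 q) := by
  have hf2 : DelKills (0 + 2) (q + 2) f := hf.mono (by omega) le_rfl
  rw [varProd_cons (by omega), ← mul_assoc, delRun_cons (by omega),
    del_mul_of_refl_eq (simpleRefl_varProd (by omega)), del_zero_mul_var (by omega),
    delRun_mul_varProd (b := 0) (by omega) hq, delRun_neg, delRun_add, zero_add,
    delRun_cons (f := f) (by omega), hf 1 le_rfl (by omega), delRun_zero]
  · ring
  · intro i h1 h2
    rw [del_neg, del_add, hf2 i h1 h2, delKills_simpleRefl_zero hf2 (by omega) i h1 h2, add_zero,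
      neg_zero]

/-- A twisted run preserves symmetry in `x_1, …, x_m`. -/
theorem delKills_twistedRun {m : ℕ} (hm : m ≤ n) {f : Pol R n} (hf : DelKills 1 m f) :
    DelKills 1 m (delRun 1 m (simpleRefl 0 f)) :=
  delKills_delRun one_pos hm
    (delKills_simpleRefl_zero (hf.mono (by omega) le_rfl) (by omega))

/-- On `f x_1 ⋯ x_{m-1}`, with `f` symmetric in `x_1, …, x_m`, the word `∇_{m-1}^B(m)` is, up to
sign, the product of twisted runs without its last factor `s_0` (here with `m + 1` in place
of `m`). -/
theorem wordB_mul_varProd_pred {m : ℕ} (hm : m + 1 ≤ n) {f : Pol R n}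
    (hf : DelKills 1 (m + 1) f) :
    wordB m (m + 1) (f * varProd R n 0 m) =
      (-1) ^ m * simpleRefl 0 (twistedRuns (m + 1) f) := by
  induction m generalizing f with
  | zero =>
    simp [wordB_zero, varProd_self, twistedRuns, delRun_of_le le_rfl, simpleRefl_simpleRefl]
  | succ m ih =>
    rw [wordB_succ, delRun_zero_mul_varProd hm hf, wordB_neg,
      ih (by omega) ((delKills_twistedRun hm hf).mono le_rfl (by omega)),
      twistedRuns_succ (m + 1)]
    ring

/-- The extra variable `x_m` passes through the run `∂_0 ⋯ ∂_{m-1}` to become `x_{m-1}`. The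
correction term is a run of length `m - 1` on a polynomial symmetric in `x_1, …, x_{m-1}`, which
the next run annihilates. -/
theorem wordB_mul_varProd {m : ℕ} (hm : m + 1 ≤ n) {f : Pol R n} (hf : DelKills 1 (m + 1) f) :
    wordB (m + 1) (m + 1) (f * varProd R n 0 (m + 1)) =
      (-1) ^ (m + 1) * (twistedRuns (m + 1) f + simpleRefl 0 (twistedRuns (m + 1) f)) := by
  induction m generalizing f with
  | zero =>
    rw [wordB_succ, varProd_cons (by omega), varProd_self, mul_one, delRun_cons (by omega),
      delRun_of_le (by omega), del_zero_mul_var (by omega), wordB_zero]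
    simp [twistedRuns, delRun_of_le le_rfl, simpleRefl_simpleRefl]
    ring
  | succ m ih =>
    set h := f * varProd R n 0 (m + 1) with hh
    have h1 : delRun 0 (m + 2) (h * var R n (m + 1)) =
        delRun 0 (m + 2) h * var R n m - delRun 0 (m + 1) h := by
      rw [delRun_succ (by omega), delRun_succ (b := m + 1) (f := h) (by omega),
        delRun_mul_of_refl_eq (fun i _ hi => simpleRefl_var_of_lt hi), del_mul_var hm]
    have h2 : DelKills 1 (m + 1) h := fun i hi hi' => by
      rw [hh, del_mul_of_refl_eq (simpleRefl_varProd_zero hi hi' (by omega)),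
        hf i hi (by omega), zero_mul]
    rw [varProd_succ (by omega), ← mul_assoc, ← hh, wordB_succ, h1, sub_eq_add_neg, wordB_add,
      wordB_neg, wordB_succ m m (delRun 0 (m + 1) h),
      delRun_zero_delRun_zero (by omega) (by omega) h2, wordB_zero_right, hh,
      delRun_zero_mul_varProd hm hf, neg_mul, mul_assoc, ← varProd_succ (by omega), wordB_neg,
      ih (by omega) ((delKills_twistedRun hm hf).mono le_rfl (by omega)),
      twistedRuns_succ (m + 1)]
    ring

end Main
end OrthDivDiff

theorem proposition6 (k : ℕ) (hk : 0 < k) (f : OrthDivDiff.Pol OrthDivDiff.ZHalf (2 * k))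
    (hf : f ∈ MvPolynomial.symmetricSubalgebra (Fin (2 * k)) OrthDivDiff.ZHalf) :
    OrthDivDiff.nablaD k (2 * k) f =
      OrthDivDiff.nablaB (2 * k) (2 * k)
          (f * OrthDivDiff.xprod OrthDivDiff.ZHalf (2 * k) (2 * k)) +
        OrthDivDiff.nablaB (2 * k - 1) (2 * k)
          (f * OrthDivDiff.xprod OrthDivDiff.ZHalf (2 * k - 1) (2 * k)) := by
  open OrthDivDiff in
  obtain ⟨m, hm⟩ : ∃ m, 2 * k = m + 1 := ⟨2 * k - 1, by omega⟩
  have hfk : DelKills 1 (m + 1) f := fun i hi _ =>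
    del_of_refl_eq (simpleRefl_of_mem_symmetricSubalgebra hi hf)
  -- The parity of the number `m + 1` of variables is what makes the two signs opposite.
  have hodd : Odd m := by
    rw [← Nat.not_even_iff_odd, ← Nat.even_add_one, ← hm]
    exact even_two_mul k
  have hD : nablaD k (2 * k) f = twistedRuns (m + 1) f :=
    (wordD_eq_twistedRuns le_rfl f).trans (congrArg (twistedRuns · f) hm)
  have hB : nablaB (2 * k) (2 * k) (f * xprod ZHalf (2 * k) (2 * k)) =
      wordB (m + 1) (m + 1) (f * varProd ZHalf (2 * k) 0 (m + 1)) := by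
    rw [xprod_eq_varProd le_rfl, ← hm]
    rfl
  have hB' : nablaB (2 * k - 1) (2 * k) (f * xprod ZHalf (2 * k - 1) (2 * k)) =
      wordB m (m + 1) (f * varProd ZHalf (2 * k) 0 m) := by
    rw [xprod_eq_varProd (by omega), show m = 2 * k - 1 by omega,
      show 2 * k - 1 + 1 = 2 * k by omega]
    rfl
  rw [hD, hB, hB', wordB_mul_varProd hm.ge hfk, wordB_mul_varProd_pred hm.ge hfk,
    hodd.add_one.neg_one_pow, hodd.neg_one_pow]
  ring
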